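/- Let $$\mathcal B:=\bigcup_{k\ge 1}\Big(\tfrac{1}{3^{k+1}},\tfrac{2}{3^{k+1}}\Big)\ \cup\ \Big(\tfrac13,\tfrac23\Big)\ \cup\ \bigcup_{k\ge 1}\Big(\tfrac{3^{k+1}-2}{3^{k+1}},\tfrac{3^{k+1}-1}{3^{k+1}}\Big)\subset(0,1).$$ For a closed interval $I=[a,b]$ with $a<b$ let $A_I(x):=a+(b-a)x$, and for a set $S\subset[0,1]$ let $\mathcal E(S)$ be the family of connected components of $S$ with non-empty interior. Define the fast subdivision $(\mathcal D_n)_{n\ge 0}$ (of the right half $\mathcal K\cap[2/3,1]$ of the middle-third Cantor set $\mathcal K$) by $\mathcal D_0:=[2/3,1]$ and $$\mathcal D_n:=\mathcal D_{n-1}\setminus\bigcup_{I\in\mathcal E(\mathcal D_{n-1})}A_I(\mathcal B)\qquad (n\ge 1).$$ Let $P(x,y):=xy$ and let $\mathcal L$ denote Lebesgue measure on $\mathbb R$. Then $$\left|\mathcal L\big(P(\mathcal D_3\times\mathcal D_3)\big)-\frac{91782451}{170061120}\right|\le\frac{1}{64\cdot 9^6}.$$ -/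

import Mathlib

namespace CantorProduct

/-- The open set `𝓑 ⊂ (0,1)`: the countable disjoint union of the open intervals
`(1/3^(k+1), 2/3^(k+1))` for `k ≥ 1`, `(1/3, 2/3)`, and
`((3^(k+1) - 2)/3^(k+1), (3^(k+1) - 1)/3^(k+1))` for `k ≥ 1`. -/
def gapSet : Set ℝ :=
  (⋃ (k : ℕ) (_ : 1 ≤ k), Set.Ioo ((1 : ℝ) / 3 ^ (k + 1)) ((2 : ℝ) / 3 ^ (k + 1))) ∪
    Set.Ioo ((1 : ℝ) / 3) ((2 : ℝ) / 3) ∪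
    ⋃ (k : ℕ) (_ : 1 ≤ k),
      Set.Ioo (((3 : ℝ) ^ (k + 1) - 2) / 3 ^ (k + 1)) (((3 : ℝ) ^ (k + 1) - 1) / 3 ^ (k + 1))

/-- For an interval `I = [a, b]` with `a < b`, the affine orientation preserving bijection
`A_I : [0,1] → I`, `x ↦ a + (b - a) x`; the endpoints are read off as `a = inf I`, `b = sup I`. -/
noncomputable def affineOnto (I : Set ℝ) (x : ℝ) : ℝ :=
  sInf I + (sSup I - sInf I) * x

/-- The family `𝓔(S)` of the connected components of `S` that have non-empty interior. -/
def intervals (S : Set ℝ) : Set (Set ℝ) :=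
  {I | (∃ x ∈ S, I = connectedComponentIn S x) ∧ (interior I).Nonempty}

/-- The fast subdivision: `𝓓₀ = [2/3, 1]` and
`𝓓ₙ₊₁ = 𝓓ₙ \ ⋃_{I ∈ 𝓔(𝓓ₙ)} A_I(𝓑)`. -/
noncomputable def fastSubdivision : ℕ → Set ℝ
  | 0 => Set.Icc (2 / 3) 1
  | n + 1 => fastSubdivision n \ ⋃ I ∈ intervals (fastSubdivision n), affineOnto I '' gapSet

/-- The product map `P(x, y) = x y`. -/
def prodMap (p : ℝ × ℝ) : ℝ := p.1 * p.2

end CantorProduct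

/-!
Write `D` for `fastSubdivision 3`. It is built from closed triadic intervals (the nodes) and
contains the Cantor points of `[2/3, 1]`. For a triadic interval `[a, a + s]` with left third `L` and
right third `R`, the products of a point of `D ∩ L` with a point of `D ∩ R` fill an interval `Q`,
namely `[(a + s/3)² - (s/3)², (a + 2s/3)² - (s/3)²]` (`Icc_subset_products`). If `D` avoids the middle
third, then the products of two points of `D ∩ [a, a + s]` are those of `D ∩ L`, those of `D ∩ R` and
`Q`, and they miss the gap of length `s² / 9` between `Q` and `(a + 2s/3)²`. If `defect a s` denotes
the measure of what is missed in `[a², (a + s)²]`, this gives the recursion (`defect_le_sub`,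
`le_defect`)

  `defect a s = s² / 9 + defect L + defect R - loss`,

where `loss` is the part of the squares of `L` that is missed by the products of `D ∩ L` but filled
by `Q`. It is of order `s⁴`, because `Q` reaches only `(s/3)²` deep into the squares of `L`
(`defectAbove_left_le`).

A node that is a component of `D` has defect `0`. Below a component of an earlier level, the nodes
form two chains, along each of which the recursion telescopes to a geometric series
(`DefectBounds.of_chain`). Going up the three levels, every node has defect `κ s²` up to an error
`s⁴ / 553`, with an explicit rational `κ` depending only on the kind of the node. For `[2/3, 1]`,
`[2/3, 7/9]` and `[8/9, 1]` this error is too large; there the loss is located more precisely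
(`defectAbove_left_third_bounds`, `le_defectAbove_left_ninth`, `defectAbove_right_ninth_bounds`).
The measure sought is `5/9 - defect (2/3) (1/3)`, so that the claim becomes rational arithmetic.
-/

namespace CantorProduct

open Set MeasureTheory

/-! ### The removed set `gapSet` and the Cantor set -/

/-- Up to the reflection `x ↦ 1 - x`, `gapSet` consists of the middle thirds of the intervals
`[0, 3⁻ᵏ]`, `k ≥ 0`. -/
lemma mem_gapSet {x : ℝ} :
    x ∈ gapSet ↔ ∃ k : ℕ, (1 / 3 ^ k / 3 < x ∧ x < 2 * (1 / 3 ^ k) / 3) ∨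
      (1 / 3 ^ k / 3 < 1 - x ∧ 1 - x < 2 * (1 / 3 ^ k) / 3) := by
  have h1 (k : ℕ) : (1 : ℝ) / 3 ^ (k + 1) = 1 / 3 ^ k / 3 := by rw [pow_succ]; field_simp
  have h2 (k : ℕ) : (2 : ℝ) / 3 ^ (k + 1) = 2 * (1 / 3 ^ k) / 3 := by rw [pow_succ]; field_simp
  have h3 (k : ℕ) : ((3 : ℝ) ^ (k + 1) - 2) / 3 ^ (k + 1) = 1 - 2 * (1 / 3 ^ k) / 3 := by
    rw [sub_div, h2, div_self (by positivity)]
  have h4 (k : ℕ) : ((3 : ℝ) ^ (k + 1) - 1) / 3 ^ (k + 1) = 1 - 1 / 3 ^ k / 3 := by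
    rw [sub_div, h1, div_self (by positivity)]
  simp only [gapSet, mem_union, mem_iUnion, mem_Ioo, h1, h2, h3, h4, exists_prop]
  constructor
  · rintro ((⟨k, -, h⟩ | h) | ⟨k, -, h⟩)
    · exact ⟨k, Or.inl h⟩
    · exact ⟨0, Or.inl (by simpa using h)⟩
    · exact ⟨k, Or.inr ⟨by linarith [h.2], by linarith [h.1]⟩⟩
  · rintro ⟨k, h | h⟩
    · rcases Nat.eq_zero_or_pos k with rfl | hk
      · exact Or.inl (Or.inr (by simpa using h))
      · exact Or.inl (Or.inl ⟨k, hk, h⟩)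
    · rcases Nat.eq_zero_or_pos k with rfl | hk
      · refine Or.inl (Or.inr ?_)
        norm_num at h
        exact ⟨by linarith [h.2], by linarith [h.1]⟩
      · exact Or.inr ⟨k, hk, by linarith [h.2], by linarith [h.1]⟩

lemma one_sub_mem_gapSet {x : ℝ} : 1 - x ∈ gapSet ↔ x ∈ gapSet := by
  simp only [mem_gapSet, sub_sub_cancel]
  exact exists_congr fun k => or_comm

lemma gapSet_subset_Ioo : gapSet ⊆ Ioo 0 1 := by
  intro x hx
  obtain ⟨k, h⟩ := mem_gapSet.1 hx
  have h0 : (0 : ℝ) < 1 / 3 ^ k := by positivity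
  have h1 : (1 : ℝ) / 3 ^ k ≤ 1 := by
    rw [div_le_one (by positivity)]; exact one_le_pow₀ (by norm_num)
  rcases h with h | h <;> constructor <;> linarith [h.1, h.2]

lemma isOpen_gapSet : IsOpen gapSet := by
  unfold gapSet
  exact ((isOpen_iUnion fun k => isOpen_iUnion fun _ => isOpen_Ioo).union isOpen_Ioo).union
    (isOpen_iUnion fun k => isOpen_iUnion fun _ => isOpen_Ioo)

lemma notMem_gapSet_of_mem_Icc {x : ℝ} {k : ℕ}
    (hx : x ∈ Icc (2 * (1 / 3 ^ (k + 1) / 3)) (1 / 3 ^ (k + 1) : ℝ)) : x ∉ gapSet := by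
  intro h
  obtain ⟨j, h⟩ := mem_gapSet.1 h
  have hk : (1 : ℝ) / 3 ^ (k + 1) = 1 / 3 ^ k / 3 := by rw [pow_succ]; field_simp
  have hmono {i j : ℕ} (hij : i ≤ j) : (1 : ℝ) / 3 ^ j ≤ 1 / 3 ^ i :=
    one_div_le_one_div_of_le (by positivity) (pow_le_pow_right₀ (by norm_num) hij)
  rcases h with h | h
  · rcases le_or_gt j k with hj | hj
    · linarith [hmono hj, h.1, hx.2]
    · linarith [hmono (show k + 1 ≤ j from hj), h.2, hx.1]
  · have h1 := hmono (Nat.zero_le j)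
    have h2 := hmono (Nat.zero_le k)
    norm_num at h1 h2
    simp only [one_div] at *
    linarith [h.2, hx.2]

lemma exists_mem_Icc_of_notMem_gapSet_of_le {x : ℝ} (hx0 : 0 < x) (hx : x ∉ gapSet)
    (hx1 : x ≤ 1 / 2) :
    ∃ k : ℕ, x ∈ Icc (2 * (1 / 3 ^ (k + 1) / 3)) (1 / 3 ^ (k + 1) : ℝ) := by
  have hgap (k : ℕ) (h : (1 : ℝ) / 3 ^ k / 3 < x) : 2 * (1 / 3 ^ k) / 3 ≤ x := by
    by_contra! hlt
    exact hx (mem_gapSet.2 ⟨k, Or.inl ⟨h, hlt⟩⟩)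
  obtain ⟨n, hn1, hn2⟩ := exists_nat_pow_near_of_lt_one hx0 (by linarith)
    (show (0 : ℝ) < 1 / 3 by norm_num) (by norm_num)
  rw [one_div_pow] at hn1 hn2
  have h1 : (1 : ℝ) / 3 ^ (n + 1) = 1 / 3 ^ n / 3 := by rw [pow_succ]; field_simp
  have h2 := hgap n (by rwa [← h1])
  rcases n with _ | k
  · norm_num at h2
    linarith
  · exact ⟨k, by linarith, hn2⟩

lemma exists_mem_Icc_of_notMem_gapSet {x : ℝ} (hx0 : 0 < x) (hx1 : x < 1) (hx : x ∉ gapSet) :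
    ∃ k : ℕ, x ∈ Icc (2 * (1 / 3 ^ (k + 1) / 3)) (1 / 3 ^ (k + 1) : ℝ) ∨
      1 - x ∈ Icc (2 * (1 / 3 ^ (k + 1) / 3)) (1 / 3 ^ (k + 1) : ℝ) := by
  rcases le_or_gt x (1 / 2) with h | h
  · obtain ⟨k, hk⟩ := exists_mem_Icc_of_notMem_gapSet_of_le hx0 hx h
    exact ⟨k, Or.inl hk⟩
  · obtain ⟨k, hk⟩ := exists_mem_Icc_of_notMem_gapSet_of_le (x := 1 - x) (by linarith)
      (by rwa [one_sub_mem_gapSet]) (by linarith)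
    exact ⟨k, Or.inr hk⟩

lemma div_three_mem_cantorSet {x : ℝ} (hx : x ∈ cantorSet) : x / 3 ∈ cantorSet := by
  rw [cantorSet_eq_union_halves]
  exact Or.inl ⟨x, hx, rfl⟩

lemma two_add_div_three_mem_cantorSet {x : ℝ} (hx : x ∈ cantorSet) :
    (2 + x) / 3 ∈ cantorSet := by
  rw [cantorSet_eq_union_halves]
  exact Or.inr ⟨x, hx, rfl⟩

lemma exists_of_mem_cantorSet {x : ℝ} (hx : x ∈ cantorSet) :
    ∃ y ∈ cantorSet, x = y / 3 ∨ x = (2 + y) / 3 := by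
  rw [cantorSet_eq_union_halves] at hx
  rcases hx with ⟨y, hy, rfl⟩ | ⟨y, hy, rfl⟩
  · exact ⟨y, hy, Or.inl rfl⟩
  · exact ⟨y, hy, Or.inr rfl⟩

lemma div_three_mem_cantorSet_iff {y : ℝ} (hy : y ≤ 1) :
    y / 3 ∈ cantorSet ↔ y ∈ cantorSet := by
  refine ⟨fun h => ?_, div_three_mem_cantorSet⟩
  obtain ⟨z, hz, h | h⟩ := exists_of_mem_cantorSet h
  · rwa [show y = z by linarith]
  · linarith [(cantorSet_subset_unitInterval hz).1]

lemma two_add_div_three_mem_cantorSet_iff {y : ℝ} (hy : 0 ≤ y) :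
    (2 + y) / 3 ∈ cantorSet ↔ y ∈ cantorSet := by
  refine ⟨fun h => ?_, two_add_div_three_mem_cantorSet⟩
  obtain ⟨z, hz, h | h⟩ := exists_of_mem_cantorSet h
  · linarith [(cantorSet_subset_unitInterval hz).2]
  · rwa [show y = z by linarith]

lemma one_sub_mem_cantorSet {x : ℝ} (hx : x ∈ cantorSet) : 1 - x ∈ cantorSet := by
  have key (n : ℕ) : ∀ x ∈ preCantorSet n, 1 - x ∈ preCantorSet n := by
    induction n with
    | zero => exact fun x hx => ⟨by linarith [hx.2], by linarith [hx.1]⟩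
    | succ n ih =>
      rintro x (⟨y, hy, rfl⟩ | ⟨y, hy, rfl⟩)
      · exact Or.inr ⟨1 - y, ih y hy, by ring⟩
      · exact Or.inl ⟨1 - y, ih y hy, by ring⟩
  exact mem_iInter.2 fun n => key n x (mem_iInter.1 hx n)

lemma disjoint_cantorSet_gapSet : Disjoint cantorSet gapSet := by
  have key (k : ℕ) : ∀ x ∈ cantorSet, ¬ (1 / 3 ^ k / 3 < x ∧ x < 2 * (1 / 3 ^ k) / 3) := by
    induction k with
    | zero =>
      rintro x hx ⟨h1, h2⟩
      norm_num at h1 h2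
      obtain ⟨y, hy, rfl | rfl⟩ := exists_of_mem_cantorSet hx
      · linarith [(cantorSet_subset_unitInterval hy).2]
      · linarith [(cantorSet_subset_unitInterval hy).1]
    | succ k ih =>
      rintro x hx ⟨h1, h2⟩
      have h3 : (1 : ℝ) / 3 ^ (k + 1) = 1 / 3 ^ k / 3 := by rw [pow_succ]; field_simp
      have h4 : (1 : ℝ) / 3 ^ k ≤ 1 := by
        rw [div_le_one (by positivity)]; exact one_le_pow₀ (by norm_num)
      rw [h3] at h1 h2
      obtain ⟨y, hy, rfl | rfl⟩ := exists_of_mem_cantorSet hx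
      · exact ih y hy ⟨by linarith, by linarith⟩
      · linarith [(cantorSet_subset_unitInterval hy).1]
  rw [Set.disjoint_left]
  intro x hx hx'
  obtain ⟨k, h | h⟩ := mem_gapSet.1 hx'
  · exact key k x hx h
  · exact key k _ (one_sub_mem_cantorSet hx) h

/-! ### Connected components of the fast subdivision -/

/-- The closed interval `[a, a + s]` coded by its left endpoint and its length. -/
def seg (p : ℝ × ℝ) : Set ℝ := Icc p.1 (p.1 + p.2)

/-- `F` codes the non-degenerate connected components of `S`: each `[a, a + s]` with `(a, s) ∈ F`
lies in `S` and cannot be enlarged inside `S`, and these intervals exhaust `S` up to a countable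
set. -/
structure IsComponentSystem (S : Set ℝ) (F : Set (ℝ × ℝ)) : Prop where
  countable : F.Countable
  pos : ∀ p ∈ F, 0 < p.2
  subset : ∀ p ∈ F, seg p ⊆ S
  gap_left : ∀ p ∈ F, ∀ ε > 0, ∃ x, p.1 - ε < x ∧ x < p.1 ∧ x ∉ S
  gap_right : ∀ p ∈ F, ∀ ε > 0, ∃ x, p.1 + p.2 < x ∧ x < p.1 + p.2 + ε ∧ x ∉ S
  countable_diff : (S \ ⋃ p ∈ F, seg p).Countable

variable {S : Set ℝ} {F : Set (ℝ × ℝ)}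

lemma IsComponentSystem.connectedComponentIn_eq (h : IsComponentSystem S F) {p : ℝ × ℝ}
    (hp : p ∈ F) {x : ℝ} (hx : x ∈ seg p) : connectedComponentIn S x = seg p := by
  have hxS := h.subset p hp hx
  have hoc : (connectedComponentIn S x).OrdConnected :=
    isPreconnected_connectedComponentIn.ordConnected
  have hmem : x ∈ connectedComponentIn S x := mem_connectedComponentIn hxS
  refine Subset.antisymm (fun y hy => ?_)
    (isPreconnected_Icc.subset_connectedComponentIn hx (h.subset p hp))
  by_contra hyp
  rcases lt_or_ge y p.1 with hlt | hge
  · obtain ⟨z, hz1, hz2, hzS⟩ := h.gap_left p hp (p.1 - y) (by linarith)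
    exact hzS (connectedComponentIn_subset S x
      (hoc.out hy hmem ⟨by linarith, by linarith [hx.1]⟩))
  · have hgt : p.1 + p.2 < y := by
      by_contra! hle
      exact hyp ⟨hge, hle⟩
    obtain ⟨z, hz1, hz2, hzS⟩ := h.gap_right p hp (y - (p.1 + p.2)) (by linarith)
    exact hzS (connectedComponentIn_subset S x
      (hoc.out hmem hy ⟨by linarith [hx.2], by linarith⟩))

lemma left_mem_seg {p : ℝ × ℝ} (hp : 0 < p.2) : p.1 ∈ seg p := ⟨le_rfl, by linarith⟩

lemma sInf_seg {p : ℝ × ℝ} (hp : 0 < p.2) : sInf (seg p) = p.1 := csInf_Icc (by linarith)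

lemma sSup_seg {p : ℝ × ℝ} (hp : 0 < p.2) : sSup (seg p) = p.1 + p.2 := csSup_Icc (by linarith)

lemma seg_inj {p q : ℝ × ℝ} (hp : 0 < p.2) (hq : 0 < q.2) (h : seg p = seg q) : p = q := by
  have h1 : p.1 = q.1 := by rw [← sInf_seg hp, ← sInf_seg hq, h]
  have h2 : p.1 + p.2 = q.1 + q.2 := by rw [← sSup_seg hp, ← sSup_seg hq, h]
  exact Prod.ext h1 (by linarith)

lemma IsComponentSystem.eq_of_mem (h : IsComponentSystem S F) {p q : ℝ × ℝ} (hp : p ∈ F)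
    (hq : q ∈ F) {x : ℝ} (hxp : x ∈ seg p) (hxq : x ∈ seg q) : p = q :=
  seg_inj (h.pos p hp) (h.pos q hq)
    ((h.connectedComponentIn_eq hp hxp).symm.trans (h.connectedComponentIn_eq hq hxq))

lemma IsComponentSystem.intervals_eq (h : IsComponentSystem S F) : intervals S = seg '' F := by
  ext I
  constructor
  · rintro ⟨⟨x, hx, rfl⟩, hI⟩
    -- A set with non-empty interior is uncountable, so it meets one of the coded intervals.
    have hunc : ¬ (connectedComponentIn S x).Countable := fun hc => by
      rw [interior_eq_empty_iff_dense_compl.2 (hc.dense_compl ℝ)] at hI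
      exact not_nonempty_empty hI
    obtain ⟨y, hyC, hyU⟩ : ∃ y ∈ connectedComponentIn S x, y ∈ ⋃ p ∈ F, seg p := by
      by_contra! hno
      have hsub : connectedComponentIn S x ⊆ S \ ⋃ p ∈ F, seg p := fun y hy =>
        ⟨connectedComponentIn_subset S x hy, hno y hy⟩
      exact hunc (h.countable_diff.mono hsub)
    simp only [mem_iUnion, exists_prop] at hyU
    obtain ⟨p, hp, hyp⟩ := hyU
    exact ⟨p, hp, by rw [_root_.connectedComponentIn_eq hyC, h.connectedComponentIn_eq hp hyp]⟩
  · rintro ⟨p, hp, rfl⟩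
    have hpos := h.pos p hp
    refine ⟨⟨p.1, h.subset p hp (left_mem_seg hpos),
      (h.connectedComponentIn_eq hp (left_mem_seg hpos)).symm⟩, ?_⟩
    rw [seg, interior_Icc]
    exact nonempty_Ioo.2 (by linarith)

/-- The part of `S` removed in one step of the fast subdivision. -/
def removed (S : Set ℝ) : Set ℝ := ⋃ I ∈ intervals S, affineOnto I '' gapSet

lemma IsComponentSystem.mem_removed (h : IsComponentSystem S F) {x : ℝ} :
    x ∈ removed S ↔ ∃ p ∈ F, ∃ y ∈ gapSet, p.1 + p.2 * y = x := by
  simp only [removed, h.intervals_eq, mem_iUnion, mem_image, exists_prop, exists_exists_and_eq_and]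
  refine exists_congr fun p => and_congr_right fun hp => ?_
  simp only [affineOnto, sInf_seg (h.pos p hp), sSup_seg (h.pos p hp), add_sub_cancel_left]

lemma IsComponentSystem.isOpen_removed (h : IsComponentSystem S F) : IsOpen (removed S) := by
  have : removed S = ⋃ p ∈ F, (fun y => p.1 + p.2 * y) '' gapSet := by
    ext x
    simp only [h.mem_removed, mem_iUnion, mem_image, exists_prop]
  rw [this]
  refine isOpen_biUnion fun p hp => ?_
  have := ((Homeomorph.mulLeft₀ p.2 (h.pos p hp).ne').trans (Homeomorph.addLeft p.1)).isOpenMap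
    _ isOpen_gapSet
  exact this

/-- The middle third of `[a, a + 3⁻ᵏ s]` is removed from a component `[a, a + s]`. -/
lemma IsComponentSystem.mem_removed_left (h : IsComponentSystem S F) {p : ℝ × ℝ} (hp : p ∈ F)
    (k : ℕ) {x : ℝ} (h1 : p.1 + p.2 / 3 ^ k / 3 < x) (h2 : x < p.1 + 2 * (p.2 / 3 ^ k) / 3) :
    x ∈ removed S := by
  have hpos := h.pos p hp
  refine h.mem_removed.2 ⟨p, hp, (x - p.1) / p.2, mem_gapSet.2 ⟨k, Or.inl ⟨?_, ?_⟩⟩, ?_⟩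
  · rw [lt_div_iff₀ hpos]
    calc 1 / 3 ^ k / 3 * p.2 = p.2 / 3 ^ k / 3 := by ring
      _ < _ := by linarith
  · rw [div_lt_iff₀ hpos]
    calc x - p.1 < 2 * (p.2 / 3 ^ k) / 3 := by linarith
      _ = _ := by ring
  · field_simp; ring

/-- The middle third of `[a + s - 3⁻ᵏ s, a + s]` is removed from a component `[a, a + s]`. -/
lemma IsComponentSystem.mem_removed_right (h : IsComponentSystem S F) {p : ℝ × ℝ} (hp : p ∈ F)
    (k : ℕ) {x : ℝ} (h1 : p.1 + p.2 - 2 * (p.2 / 3 ^ k) / 3 < x)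
    (h2 : x < p.1 + p.2 - p.2 / 3 ^ k / 3) : x ∈ removed S := by
  have hpos := h.pos p hp
  refine h.mem_removed.2 ⟨p, hp, (x - p.1) / p.2, mem_gapSet.2 ⟨k, Or.inr ?_⟩, ?_⟩
  · rw [show 1 - (x - p.1) / p.2 = (p.1 + p.2 - x) / p.2 by field_simp; ring]
    constructor
    · rw [lt_div_iff₀ hpos]
      calc 1 / 3 ^ k / 3 * p.2 = p.2 / 3 ^ k / 3 := by ring
        _ < _ := by linarith
    · rw [div_lt_iff₀ hpos]
      calc p.1 + p.2 - x < 2 * (p.2 / 3 ^ k) / 3 := by linarith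
        _ = _ := by ring
  · field_simp; ring

/-- The intervals into which one step of the fast subdivision cuts the intervals coded by `F`. -/
def children (F : Set (ℝ × ℝ)) : Set (ℝ × ℝ) :=
  {q | ∃ p ∈ F, ∃ k : ℕ,
    q = (p.1 + 2 * (p.2 / 3 ^ (k + 1) / 3), p.2 / 3 ^ (k + 1) / 3) ∨
    q = (p.1 + p.2 - p.2 / 3 ^ (k + 1), p.2 / 3 ^ (k + 1) / 3)}

lemma countable_children (hF : F.Countable) : (children F).Countable := by
  have : children F ⊆ ⋃ p ∈ F, ⋃ k : ℕ,
      {(p.1 + 2 * (p.2 / 3 ^ (k + 1) / 3), p.2 / 3 ^ (k + 1) / 3),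
        (p.1 + p.2 - p.2 / 3 ^ (k + 1), p.2 / 3 ^ (k + 1) / 3)} := by
    rintro q ⟨p, hp, k, hq⟩
    simp only [mem_iUnion]
    exact ⟨p, hp, k, hq⟩
  exact (hF.biUnion fun p _ => countable_iUnion fun k => (Set.toFinite _).countable).mono this

/-- A child interval consists of the points `a + s y` with `y` in a component of
`[0, 1] \ gapSet`. -/
lemma exists_of_mem_children {q : ℝ × ℝ} (hF : ∀ p ∈ F, 0 < p.2) (hq : q ∈ children F) {x : ℝ}
    (hx : x ∈ seg q) : ∃ p ∈ F, ∃ y ∈ Icc (0 : ℝ) 1, y ∉ gapSet ∧ x = p.1 + p.2 * y := by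
  obtain ⟨p, hp, k, hq⟩ := hq
  have hpos := hF p hp
  have hr : p.2 / 3 ^ (k + 1) = p.2 * (1 / 3 ^ (k + 1)) := by ring
  have hr1 : (1 : ℝ) / 3 ^ (k + 1) ≤ 1 := by
    rw [div_le_one (by positivity)]; exact one_le_pow₀ (by norm_num)
  have hr0 : (0 : ℝ) < 1 / 3 ^ (k + 1) := by positivity
  obtain ⟨y, rfl⟩ : ∃ y, x = p.1 + p.2 * y := ⟨(x - p.1) / p.2, by field_simp; ring⟩
  rw [hr] at hq
  refine ⟨p, hp, y, ?_⟩
  rcases hq with rfl | rfl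
  · have h1 : 2 * (1 / 3 ^ (k + 1) / 3) ≤ y := by
      refine le_of_mul_le_mul_left ?_ hpos
      have := hx.1
      simp only at this
      linarith
    have h2 : y ≤ 1 / 3 ^ (k + 1) := by
      refine le_of_mul_le_mul_left ?_ hpos
      have := hx.2
      simp only at this
      linarith
    exact ⟨⟨by linarith, by linarith⟩, notMem_gapSet_of_mem_Icc ⟨h1, h2⟩, rfl⟩
  · have h1 : 2 * (1 / 3 ^ (k + 1) / 3) ≤ 1 - y := by
      refine le_of_mul_le_mul_left ?_ hpos
      have := hx.2
      simp only at this
      linarith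
    have h2 : 1 - y ≤ 1 / 3 ^ (k + 1) := by
      refine le_of_mul_le_mul_left ?_ hpos
      have := hx.1
      simp only at this
      linarith
    refine ⟨⟨by linarith, by linarith⟩, ?_, rfl⟩
    rw [← one_sub_mem_gapSet]
    exact notMem_gapSet_of_mem_Icc ⟨h1, h2⟩

lemma exists_children_of_notMem_gapSet {p : ℝ × ℝ} (hp : p ∈ F) (hpos : 0 < p.2) {y : ℝ}
    (h0 : 0 < y) (h1 : y < 1) (hy : y ∉ gapSet) :
    ∃ q ∈ children F, p.1 + p.2 * y ∈ seg q := by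
  obtain ⟨k, h | h⟩ := exists_mem_Icc_of_notMem_gapSet h0 h1 hy
  · refine ⟨_, ⟨p, hp, k, Or.inl rfl⟩, ?_⟩
    have e1 := mul_le_mul_of_nonneg_left h.1 hpos.le
    have e2 := mul_le_mul_of_nonneg_left h.2 hpos.le
    rw [show p.2 / 3 ^ (k + 1) = p.2 * (1 / 3 ^ (k + 1)) by ring]
    constructor <;> simp only <;> linarith
  · refine ⟨_, ⟨p, hp, k, Or.inr rfl⟩, ?_⟩
    have e1 := mul_le_mul_of_nonneg_left h.1 hpos.le
    have e2 := mul_le_mul_of_nonneg_left h.2 hpos.le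
    rw [show p.2 / 3 ^ (k + 1) = p.2 * (1 / 3 ^ (k + 1)) by ring]
    constructor <;> simp only <;> linarith

lemma IsComponentSystem.step (h : IsComponentSystem S F) :
    IsComponentSystem (S \ removed S) (children F) where
  countable := countable_children h.countable
  pos := by
    rintro q ⟨p, hp, k, rfl | rfl⟩ <;>
    · have := h.pos p hp
      simp only
      positivity
  subset := by
    intro q hq x hx
    obtain ⟨p, hp, y, hy, hyg, rfl⟩ := exists_of_mem_children h.pos hq hx
    have hpos := h.pos p hp
    have hmem {p : ℝ × ℝ} (hpos : 0 < p.2) {y : ℝ} (hy : y ∈ Icc (0 : ℝ) 1) :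
        p.1 + p.2 * y ∈ seg p :=
      ⟨by linarith [mul_nonneg hpos.le hy.1], by nlinarith [hy.2]⟩
    refine ⟨h.subset p hp (hmem hpos hy), fun hr => ?_⟩
    obtain ⟨p', hp', y', hy', he⟩ := h.mem_removed.1 hr
    have hmem' : p.1 + p.2 * y ∈ seg p' := by
      rw [← he]
      exact hmem (h.pos p' hp') (Ioo_subset_Icc_self (gapSet_subset_Ioo hy'))
    obtain rfl := h.eq_of_mem hp hp' (hmem hpos hy) hmem'
    have : y' = y := mul_left_cancel₀ hpos.ne' (by linarith)
    exact hyg (this ▸ hy')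
  gap_left := by
    rintro q ⟨p, hp, k, hq⟩ ε hε
    have hpos := h.pos p hp
    have hr0 : 0 < p.2 / 3 ^ (k + 1) := by positivity
    have hr : p.2 / 3 ^ (k + 1) = p.2 / 3 ^ k / 3 := by rw [pow_succ]; field_simp
    have hm1 := min_le_left ε (p.2 / 3 ^ (k + 1) / 3)
    have hm2 := min_le_right ε (p.2 / 3 ^ (k + 1) / 3)
    have hm0 : 0 < min ε (p.2 / 3 ^ (k + 1) / 3) := lt_min hε (by positivity)
    refine ⟨q.1 - min ε (p.2 / 3 ^ (k + 1) / 3) / 2, by linarith, by linarith, fun hx => hx.2 ?_⟩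
    rcases hq with rfl | rfl
    · exact h.mem_removed_left hp (k + 1) (by simp only; linarith) (by simp only; linarith)
    · exact h.mem_removed_right hp k (by simp only; linarith) (by simp only; linarith)
  gap_right := by
    rintro q ⟨p, hp, k, hq⟩ ε hε
    have hpos := h.pos p hp
    have hr0 : 0 < p.2 / 3 ^ (k + 1) := by positivity
    have hr : p.2 / 3 ^ (k + 1) = p.2 / 3 ^ k / 3 := by rw [pow_succ]; field_simp
    have hm1 := min_le_left ε (p.2 / 3 ^ (k + 1) / 3)
    have hm2 := min_le_right ε (p.2 / 3 ^ (k + 1) / 3)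
    have hm0 : 0 < min ε (p.2 / 3 ^ (k + 1) / 3) := lt_min hε (by positivity)
    refine ⟨q.1 + q.2 + min ε (p.2 / 3 ^ (k + 1) / 3) / 2, by linarith, by linarith,
      fun hx => hx.2 ?_⟩
    rcases hq with rfl | rfl
    · exact h.mem_removed_left hp k (by simp only; linarith) (by simp only; linarith)
    · exact h.mem_removed_right hp (k + 1) (by simp only; linarith) (by simp only; linarith)
  countable_diff := by
    have hends : (⋃ p ∈ F, ({p.1, p.1 + p.2} : Set ℝ)).Countable :=
      h.countable.biUnion fun p _ => (Set.toFinite _).countable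
    refine (h.countable_diff.union hends).mono ?_
    rintro x ⟨⟨hxS, hxr⟩, hxc⟩
    by_cases hxU : x ∈ ⋃ p ∈ F, seg p
    · right
      simp only [mem_iUnion, exists_prop] at hxU ⊢
      obtain ⟨p, hp, hxp⟩ := hxU
      have hpos := h.pos p hp
      refine ⟨p, hp, ?_⟩
      by_contra hne
      simp only [mem_insert_iff, mem_singleton_iff, not_or] at hne
      obtain ⟨y, rfl⟩ : ∃ y, x = p.1 + p.2 * y := ⟨(x - p.1) / p.2, by field_simp; ring⟩
      have h0 : 0 < y := by
        have : 0 < p.2 * y := lt_of_le_of_ne (by linarith [hxp.1]) (fun h0 => hne.1 (by linarith))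
        exact pos_of_mul_pos_right this hpos.le
      have h1 : y < 1 := by
        have h2 : p.2 * y < p.2 * 1 :=
          lt_of_le_of_ne (by linarith [hxp.2]) (fun h0 => hne.2 (by linarith))
        exact lt_of_mul_lt_mul_left h2 hpos.le
      have hyg : y ∉ gapSet := fun hy => hxr (h.mem_removed.2 ⟨p, hp, y, hy, rfl⟩)
      obtain ⟨q, hq, hxq⟩ := exists_children_of_notMem_gapSet hp hpos h0 h1 hyg
      exact hxc (mem_biUnion hq hxq)
    · exact Or.inl ⟨hxS, hxU⟩

/-- Codes of the non-degenerate components of `fastSubdivision n`. -/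
def leaves : ℕ → Set (ℝ × ℝ)
  | 0 => {(2 / 3, 1 / 3)}
  | n + 1 => children (leaves n)

lemma isComponentSystem_fastSubdivision (n : ℕ) :
    IsComponentSystem (fastSubdivision n) (leaves n) := by
  induction n with
  | zero =>
    have hseg : seg (2 / 3, 1 / 3) = Icc (2 / 3) 1 := by rw [seg]; norm_num
    constructor
    · exact countable_singleton _
    · rintro p rfl; norm_num
    · rintro p rfl; rw [hseg]; exact Subset.rfl
    · rintro p rfl ε hε
      exact ⟨2 / 3 - ε / 2, by simp only; linarith, by simp only; linarith,
        fun h => by linarith [h.1]⟩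
    · rintro p rfl ε hε
      exact ⟨1 + ε / 2, by simp only; linarith, by simp only; linarith,
        fun h => by linarith [h.2]⟩
    · refine countable_empty.mono ?_
      rintro x ⟨hx, hx'⟩
      exact hx' (mem_biUnion (mem_singleton _) (by rwa [hseg]))
  | succ n ih => exact ih.step

lemma isCompact_fastSubdivision (n : ℕ) : IsCompact (fastSubdivision n) := by
  induction n with
  | zero => exact isCompact_Icc
  | succ n ih => exact ih.diff (isComponentSystem_fastSubdivision n).isOpen_removed

lemma fastSubdivision_antitone : Antitone fastSubdivision :=
  antitone_nat_of_succ_le fun _ => sdiff_subset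

/-! ### Triadic intervals -/

/-- `[a, a + s] ⊆ [2/3, 1]` is one of the closed triadic intervals arising in the construction of
the Cantor set: the affine map `[0, 1] → [a, a + s]` identifies the Cantor set with its part in
`[a, a + s]`. -/
structure IsTriadic (a s : ℝ) : Prop where
  size : ∃ m : ℕ, s = 1 / 3 ^ m
  le : 2 / 3 ≤ a
  add_le : a + s ≤ 1
  mem_iff : ∀ y ∈ Icc (0 : ℝ) 1, a + s * y ∈ cantorSet ↔ y ∈ cantorSet

lemma IsTriadic.pos {a s : ℝ} (h : IsTriadic a s) : 0 < s := by
  obtain ⟨m, rfl⟩ := h.size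
  positivity

lemma IsTriadic.left {a s : ℝ} (h : IsTriadic a s) : IsTriadic a (s / 3) where
  size := by
    obtain ⟨m, rfl⟩ := h.size
    exact ⟨m + 1, by rw [pow_succ]; field_simp⟩
  le := h.le
  add_le := by linarith [h.pos, h.add_le]
  mem_iff y hy := by
    rw [← div_three_mem_cantorSet_iff hy.2, ← h.mem_iff (y / 3)
      ⟨by linarith [hy.1], by linarith [hy.2]⟩]
    ring_nf

lemma IsTriadic.right {a s : ℝ} (h : IsTriadic a s) : IsTriadic (a + 2 * (s / 3)) (s / 3) where
  size := h.left.size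
  le := by linarith [h.pos, h.le]
  add_le := by linarith [h.add_le]
  mem_iff y hy := by
    rw [← two_add_div_three_mem_cantorSet_iff hy.1, ← h.mem_iff ((2 + y) / 3)
      ⟨by linarith [hy.1], by linarith [hy.2]⟩]
    ring_nf

lemma IsTriadic.spine_left {a s : ℝ} (h : IsTriadic a s) (k : ℕ) :
    IsTriadic a (s / 3 ^ k) := by
  induction k with
  | zero => simpa using h
  | succ k ih =>
    have := ih.left
    rwa [show s / 3 ^ k / 3 = s / 3 ^ (k + 1) by rw [pow_succ]; field_simp] at this

lemma IsTriadic.spine_right {a s : ℝ} (h : IsTriadic a s) (k : ℕ) :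
    IsTriadic (a + s - s / 3 ^ k) (s / 3 ^ k) := by
  induction k with
  | zero => simpa using h
  | succ k ih =>
    have := ih.right
    have e : s / 3 ^ k / 3 = s / 3 ^ (k + 1) := by rw [pow_succ]; field_simp
    rw [e] at this
    convert this using 1
    rw [← e]
    ring

lemma isTriadic_of_mem_leaves {n : ℕ} {p : ℝ × ℝ} (hp : p ∈ leaves n) : IsTriadic p.1 p.2 := by
  induction n generalizing p with
  | zero =>
    obtain rfl : p = (2 / 3, 1 / 3) := hp
    refine ⟨⟨1, by norm_num⟩, le_rfl, by norm_num, fun y hy => ?_⟩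
    rw [← two_add_div_three_mem_cantorSet_iff hy.1]
    ring_nf
  | succ n ih =>
    obtain ⟨q, hq, k, rfl | rfl⟩ := hp
    · exact ((ih hq).spine_left (k + 1)).right
    · exact ((ih hq).spine_right (k + 1)).left

/-- The fast subdivision only removes points outside the Cantor set. -/
lemma cantorSet_inter_subset_fastSubdivision (n : ℕ) :
    cantorSet ∩ Icc (2 / 3) 1 ⊆ fastSubdivision n := by
  induction n with
  | zero => exact inter_subset_right
  | succ n ih =>
    refine fun x hx => ⟨ih hx, fun hr => ?_⟩
    obtain ⟨p, hp, y, hy, rfl⟩ := (isComponentSystem_fastSubdivision n).mem_removed.1 hr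
    exact disjoint_left.1 disjoint_cantorSet_gapSet
      (((isTriadic_of_mem_leaves hp).mem_iff y
        (Ioo_subset_Icc_self (gapSet_subset_Ioo hy))).1 hx.1) hy

/-! ### Products of two separated triadic intervals -/

/-- The product set of two triadic intervals of the same length `s`, one to the left of the other,
is filled by the products of their Cantor points: each of the four products of thirds overlaps the
next one. -/
lemma exists_cantorSet_mul_near (n : ℕ) : ∀ {a c s z : ℝ}, 0 < s → c + s ≤ a → 1 / 3 ≤ c →
    a + s ≤ 1 → a * c ≤ z → z ≤ (a + s) * (c + s) →
    ∃ x ∈ cantorSet, ∃ y ∈ cantorSet, |(a + s * x) * (c + s * y) - z| ≤ 2 * s / 3 ^ n := by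
  induction n with
  | zero =>
    intro a c s z hs hca hc ha h1 h2
    refine ⟨0, zero_mem_cantorSet, 0, zero_mem_cantorSet, ?_⟩
    simp only [mul_zero, add_zero, pow_zero, div_one]
    rw [abs_le]
    constructor <;> nlinarith
  | succ n ih =>
    intro a c s z hs hca hc ha h1 h2
    obtain ⟨t, rfl⟩ : ∃ t, s = 3 * t := ⟨s / 3, by ring⟩
    have ht : 0 < t := by linarith
    have hb : 2 * t / 3 ^ n = 2 * (3 * t) / 3 ^ (n + 1) := by rw [pow_succ]; field_simp
    rcases le_or_gt z ((a + t) * (c + t)) with h3 | h3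
    · obtain ⟨x, hx, y, hy, h⟩ := ih (a := a) (c := c) ht (by linarith) hc (by linarith) h1 h3
      refine ⟨x / 3, div_three_mem_cantorSet hx, y / 3, div_three_mem_cantorSet hy, ?_⟩
      rw [← hb]
      convert h using 3
      ring
    rcases le_or_gt z ((a + 3 * t) * (c + t)) with h4 | h4
    · obtain ⟨x, hx, y, hy, h⟩ := ih (a := a + 2 * t) (c := c) (z := z) ht (by linarith) hc
        (by linarith) (by nlinarith) (by linarith)
      refine ⟨(2 + x) / 3, two_add_div_three_mem_cantorSet hx, y / 3,
        div_three_mem_cantorSet hy, ?_⟩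
      rw [← hb]
      convert h using 3
      ring
    rcases le_or_gt z ((a + t) * (c + 3 * t)) with h5 | h5
    · obtain ⟨x, hx, y, hy, h⟩ := ih (a := a) (c := c + 2 * t) (z := z) ht (by linarith)
        (by linarith) (by linarith) (by nlinarith) (by linarith)
      refine ⟨x / 3, div_three_mem_cantorSet hx, (2 + y) / 3,
        two_add_div_three_mem_cantorSet hy, ?_⟩
      rw [← hb]
      convert h using 3
      ring
    · obtain ⟨x, hx, y, hy, h⟩ := ih (a := a + 2 * t) (c := c + 2 * t) (z := z) ht (by linarith)
        (by linarith) (by linarith) (by nlinarith) (by linarith)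
      refine ⟨(2 + x) / 3, two_add_div_three_mem_cantorSet hx, (2 + y) / 3,
        two_add_div_three_mem_cantorSet hy, ?_⟩
      rw [← hb]
      convert h using 3
      ring

/-- The products of two points of `D ∩ [a, a + s]`. -/
def products (D : Set ℝ) (a s : ℝ) : Set ℝ :=
  prodMap '' ((D ∩ Icc a (a + s)) ×ˢ (D ∩ Icc a (a + s)))

variable {D : Set ℝ} {a s q : ℝ}

lemma mul_mem_products {x y : ℝ} (hx : x ∈ D) (hx' : x ∈ Icc a (a + s)) (hy : y ∈ D)
    (hy' : y ∈ Icc a (a + s)) : x * y ∈ products D a s :=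
  ⟨(x, y), ⟨⟨hx, hx'⟩, ⟨hy, hy'⟩⟩, rfl⟩

lemma products_mono {a' s' : ℝ} (h1 : a ≤ a') (h2 : a' + s' ≤ a + s) :
    products D a' s' ⊆ products D a s :=
  image_mono (prod_mono (inter_subset_inter_right _ (Icc_subset_Icc h1 h2))
    (inter_subset_inter_right _ (Icc_subset_Icc h1 h2)))

lemma isCompact_image_prodMap {A B : Set ℝ} (hA : IsCompact A) (hB : IsCompact B) :
    IsCompact (prodMap '' (A ×ˢ B)) :=
  (hA.prod hB).image (continuous_fst.mul continuous_snd)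

lemma measurableSet_products (hD : IsCompact D) : MeasurableSet (products D a s) :=
  (isCompact_image_prodMap (hD.inter_right isClosed_Icc)
    (hD.inter_right isClosed_Icc)).measurableSet

lemma products_subset_Icc (ha : 0 ≤ a) : products D a s ⊆ Icc (a ^ 2) ((a + s) ^ 2) := by
  rintro _ ⟨⟨x, y⟩, ⟨⟨-, hx⟩, -, hy⟩, rfl⟩
  simp only [mem_Icc, prodMap] at *
  constructor <;> nlinarith

/-- The products of a point in the left third with a point in the right third of a triadic
interval fill an interval. -/
lemma Icc_subset_products (hK : cantorSet ∩ Icc (2 / 3) 1 ⊆ D) (h : IsTriadic a s) :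
    Icc ((a + s / 3) ^ 2 - (s / 3) ^ 2) ((a + 2 * (s / 3)) ^ 2 - (s / 3) ^ 2)
      ⊆ products D a s := by
  have hs := h.pos
  have hle := h.le
  have hadd := h.add_le
  set M := prodMap '' ((cantorSet ∩ Icc (a + 2 * (s / 3)) (a + s)) ×ˢ
    (cantorSet ∩ Icc a (a + s / 3))) with hM
  have hMc : IsCompact M := isCompact_image_prodMap (isCompact_cantorSet.inter_right isClosed_Icc)
    (isCompact_cantorSet.inter_right isClosed_Icc)
  have hMD : M ⊆ products D a s := by
    refine image_mono (prod_mono ?_ ?_)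
    · exact fun x hx => ⟨hK ⟨hx.1, by linarith [hx.2.1], by linarith [hx.2.2]⟩,
        by linarith [hx.2.1], by linarith [hx.2.2]⟩
    · exact fun x hx => ⟨hK ⟨hx.1, by linarith [hx.2.1], by linarith [hx.2.2]⟩,
        by linarith [hx.2.1], by linarith [hx.2.2]⟩
  refine fun z hz => hMD ?_
  rw [← hMc.isClosed.closure_eq, Metric.mem_closure_iff]
  intro ε hε
  obtain ⟨n, hn⟩ : ∃ n : ℕ, 2 * (s / 3) / 3 ^ n < ε := by
    obtain ⟨n, hn⟩ := exists_pow_lt_of_lt_one (show 0 < ε / (2 * (s / 3)) by positivity)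
      (show (1 / 3 : ℝ) < 1 by norm_num)
    refine ⟨n, ?_⟩
    rw [lt_div_iff₀ (by positivity)] at hn
    calc 2 * (s / 3) / 3 ^ n = (1 / 3) ^ n * (2 * (s / 3)) := by rw [one_div_pow]; ring
      _ < ε := hn
  obtain ⟨x, hx, y, hy, hxy⟩ := exists_cantorSet_mul_near n (a := a + 2 * (s / 3)) (c := a)
    (s := s / 3) (z := z) (by linarith) (by linarith) (by linarith) (by linarith)
    (by linarith [hz.1]) (by linarith [hz.2])
  have hx01 := cantorSet_subset_unitInterval hx
  have hy01 := cantorSet_subset_unitInterval hy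
  refine ⟨_, ⟨(a + 2 * (s / 3) + s / 3 * x, a + s / 3 * y), ⟨⟨?_, ?_⟩, ?_, ?_⟩, rfl⟩, ?_⟩
  · exact (h.right.mem_iff x hx01).2 hx
  · constructor <;> nlinarith [hx01.1, hx01.2]
  · exact (h.left.mem_iff y hy01).2 hy
  · constructor <;> nlinarith [hy01.1, hy01.2]
  · rw [dist_comm, Real.dist_eq]
    exact hxy.trans_lt hn

/-! ### The defect of a triadic interval -/

/-- The measure of the set of points of `[q, (a + s)²]` that are not products of two points of
`D ∩ [a, a + s]`. -/
noncomputable def defectAbove (D : Set ℝ) (a s q : ℝ) : ℝ :=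
  volume.real (Icc q ((a + s) ^ 2) \ products D a s)

/-- The measure of the set of points of `[a², (a + s)²]` that are not products of two points of
`D ∩ [a, a + s]`. -/
noncomputable def defect (D : Set ℝ) (a s : ℝ) : ℝ := defectAbove D a s (a ^ 2)

lemma measure_Icc_diff_ne_top {q r : ℝ} {A : Set ℝ} : volume (Icc q r \ A) ≠ ⊤ :=
  ((measure_mono sdiff_subset).trans_lt measure_Icc_lt_top).ne

lemma measure_Ico_diff_ne_top {q r : ℝ} {A : Set ℝ} : volume (Ico q r \ A) ≠ ⊤ :=
  ((measure_mono sdiff_subset).trans_lt measure_Ico_lt_top).ne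

lemma defectAbove_nonneg : 0 ≤ defectAbove D a s q := measureReal_nonneg

lemma defect_nonneg : 0 ≤ defect D a s := measureReal_nonneg

/-- Passing to a larger interval with the same right endpoint can only decrease the defect. -/
lemma defectAbove_le_of_top_eq {a' s' q' : ℝ} (hq : q' ≤ q) (ha : a ≤ a')
    (htop : a + s = a' + s') : defectAbove D a s q ≤ defectAbove D a' s' q' := by
  refine measureReal_mono ?_ measure_Icc_diff_ne_top
  rw [htop]
  exact sdiff_subset_sdiff (Icc_subset_Icc_left hq) (products_mono ha htop.ge)

lemma defect_eq_zero (hs : 0 ≤ s) (ha : 0 ≤ a) (h : Icc a (a + s) ⊆ D) : defect D a s = 0 := by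
  have : Icc (a ^ 2) ((a + s) ^ 2) \ products D a s = ∅ := by
    rw [sdiff_eq_empty]
    rintro z ⟨hz1, hz2⟩
    have hz0 : 0 ≤ z := (sq_nonneg a).trans hz1
    have hmem : √z ∈ Icc a (a + s) := ⟨Real.le_sqrt_of_sq_le hz1, by
      rw [Real.sqrt_le_left (by linarith)]; exact hz2⟩
    rw [← Real.mul_self_sqrt hz0]
    exact mul_mem_products (h hmem) hmem (h hmem) hmem
  rw [defect, defectAbove, this, measureReal_empty]

lemma defect_le (hs : 0 ≤ s) (ha : 0 ≤ a) (h1 : a + s ≤ 1) : defect D a s ≤ 2 * s := by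
  have h : defect D a s ≤ volume.real (Icc (a ^ 2) ((a + s) ^ 2)) :=
    measureReal_mono sdiff_subset measure_Icc_lt_top.ne
  rw [Real.volume_real_Icc_of_le (by nlinarith)] at h
  nlinarith

/-- `D ∩ [a, a + s]` avoids the open middle third of `[a, a + s]`. -/
def Splits (D : Set ℝ) (a s : ℝ) : Prop :=
  ∀ x ∈ D, x ∈ Icc a (a + s) → x ≤ a + s / 3 ∨ a + 2 * (s / 3) ≤ x

/-- Products of two points of `D ∩ [a, a + s]`, sorted by the thirds containing the factors. -/
lemma Splits.mem_products (h : Splits D a s) (hs : 0 ≤ s) (ha : 0 ≤ a) {z : ℝ}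
    (hz : z ∈ products D a s) :
    z ∈ products D a (s / 3) ∨
      z ∈ Icc ((a + s / 3) ^ 2 - (s / 3) ^ 2) ((a + 2 * (s / 3)) ^ 2 - (s / 3) ^ 2) ∨
      z ∈ products D (a + 2 * (s / 3)) (s / 3) := by
  obtain ⟨⟨x, y⟩, ⟨⟨hxD, hx⟩, hyD, hy⟩, rfl⟩ := hz
  have cross {x y : ℝ} (hx : x ∈ Icc a (a + s)) (hy : y ∈ Icc a (a + s)) (h1 : x ≤ a + s / 3)
      (h2 : a + 2 * (s / 3) ≤ y) :
      x * y ∈ Icc ((a + s / 3) ^ 2 - (s / 3) ^ 2) ((a + 2 * (s / 3)) ^ 2 - (s / 3) ^ 2) := by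
    constructor
    · calc (a + s / 3) ^ 2 - (s / 3) ^ 2 = a * (a + 2 * (s / 3)) := by ring
        _ ≤ x * y := mul_le_mul hx.1 h2 (by positivity) (ha.trans hx.1)
    · calc x * y ≤ (a + s / 3) * (a + s) :=
          mul_le_mul h1 hy.2 (ha.trans hy.1) (by positivity)
        _ = _ := by ring
  simp only [prodMap] at *
  rcases h x hxD hx with hx' | hx' <;> rcases h y hyD hy with hy' | hy'
  · exact Or.inl (mul_mem_products hxD ⟨hx.1, hx'⟩ hyD ⟨hy.1, hy'⟩)
  · exact Or.inr (Or.inl (cross hx hy hx' hy'))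
  · rw [mul_comm]
    exact Or.inr (Or.inl (cross hy hx hy' hx'))
  · exact Or.inr (Or.inr (mul_mem_products hxD ⟨hx', by linarith [hx.2]⟩ hyD
      ⟨hy', by linarith [hy.2]⟩))

lemma volume_real_gap : volume.real
    (Ioo ((a + 2 * (s / 3)) ^ 2 - (s / 3) ^ 2) ((a + 2 * (s / 3)) ^ 2)) = s ^ 2 / 9 := by
  rw [Real.volume_real_Ioo_of_le (by linarith [sq_nonneg (s / 3)])]
  ring

/-- Splitting the defect at the threshold `q`. -/
lemma defect_eq_add_defectAbove (hD : IsCompact D) (h1 : a ^ 2 ≤ q) (h2 : q ≤ (a + s) ^ 2) :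
    defect D a s = volume.real (Ico (a ^ 2) q \ products D a s) + defectAbove D a s q := by
  rw [defect, defectAbove, defectAbove, ← measureReal_union _
    (measurableSet_Icc.diff (measurableSet_products hD)) measure_Ico_diff_ne_top
    measure_Icc_diff_ne_top, ← union_sdiff_distrib, Ico_union_Icc_eq_Icc h1 h2]
  exact (Set.disjoint_left.2 fun x hx hx' => not_lt.2 hx'.1 hx.2).mono sdiff_subset sdiff_subset

/-- Above the products of the left third with the right third of `[a, a + s]`, the only points
missed are those of the gap below `(a + 2 s / 3)²` and those missed by the right third. -/
lemma defectAbove_le (hK : cantorSet ∩ Icc (2 / 3) 1 ⊆ D) (h : IsTriadic a s)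
    (hq : (a + s / 3) ^ 2 - (s / 3) ^ 2 ≤ q) :
    defectAbove D a s q ≤ s ^ 2 / 9 + defect D (a + 2 * (s / 3)) (s / 3) := by
  have hs := h.pos
  have hsub : Icc q ((a + s) ^ 2) \ products D a s ⊆
      Ioo ((a + 2 * (s / 3)) ^ 2 - (s / 3) ^ 2) ((a + 2 * (s / 3)) ^ 2) ∪
      (Icc ((a + 2 * (s / 3)) ^ 2) ((a + 2 * (s / 3) + s / 3) ^ 2) \
        products D (a + 2 * (s / 3)) (s / 3)) := by
    rintro z ⟨⟨hz1, hz2⟩, hzP⟩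
    have hgap : (a + 2 * (s / 3)) ^ 2 - (s / 3) ^ 2 < z := by
      by_contra! hle
      exact hzP (Icc_subset_products hK h ⟨hq.trans hz1, hle⟩)
    rcases lt_or_ge z ((a + 2 * (s / 3)) ^ 2) with hz | hz
    · exact Or.inl ⟨hgap, hz⟩
    · refine Or.inr ⟨⟨hz, ?_⟩, fun hzR => hzP (products_mono (by linarith) (by linarith) hzR)⟩
      rwa [show a + 2 * (s / 3) + s / 3 = a + s by ring]
  calc defectAbove D a s q ≤ _ := measureReal_mono hsub
        (measure_union_ne_top measure_Ioo_lt_top.ne measure_Icc_diff_ne_top)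
    _ ≤ _ := measureReal_union_le _ _
    _ = _ := by rw [volume_real_gap]; rfl

/-- If `D` avoids the middle third of `[a, a + s]`, then the gap below `(a + 2 s / 3)²` is missed
entirely. -/
lemma le_defectAbove (hD : IsCompact D) (hsp : Splits D a s) (hs : 0 < s) (ha : 0 ≤ a)
    (hq : q ≤ (a + 2 * (s / 3)) ^ 2 - (s / 3) ^ 2) :
    s ^ 2 / 9 + defect D (a + 2 * (s / 3)) (s / 3) ≤ defectAbove D a s q := by
  have htop : a + 2 * (s / 3) + s / 3 = a + s := by ring
  have hsq : (a + 2 * (s / 3)) ^ 2 ≤ (a + s) ^ 2 := by gcongr; linarith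
  have hgap : (a + s / 3) ^ 2 ≤ (a + 2 * (s / 3)) ^ 2 - (s / 3) ^ 2 := by nlinarith
  have hsub : Ioo ((a + 2 * (s / 3)) ^ 2 - (s / 3) ^ 2) ((a + 2 * (s / 3)) ^ 2) ∪
      (Icc ((a + 2 * (s / 3)) ^ 2) ((a + 2 * (s / 3) + s / 3) ^ 2) \
        products D (a + 2 * (s / 3)) (s / 3)) ⊆ Icc q ((a + s) ^ 2) \ products D a s := by
    rintro z (⟨hz1, hz2⟩ | ⟨⟨hz1, hz2⟩, hzP⟩)
    · refine ⟨⟨by linarith, by linarith⟩, fun hz => ?_⟩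
      rcases hsp.mem_products hs.le ha hz with hz | hz | hz
      · linarith [(products_subset_Icc ha hz).2]
      · linarith [hz.2]
      · linarith [(products_subset_Icc (by positivity) hz).1]
    · rw [htop] at hz2
      have hs2 : 0 < (s / 3) ^ 2 := by positivity
      refine ⟨⟨by linarith, hz2⟩, fun hz => ?_⟩
      rcases hsp.mem_products hs.le ha hz with hz | hz | hz
      · linarith [(products_subset_Icc ha hz).2]
      · linarith [hz.2]
      · exact hzP hz
  calc s ^ 2 / 9 + defect D (a + 2 * (s / 3)) (s / 3) = _ := by
        rw [← volume_real_gap (a := a), defect, defectAbove, ← measureReal_union _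
          (measurableSet_Icc.diff (measurableSet_products hD)) measure_Ioo_lt_top.ne
          measure_Icc_diff_ne_top]
        exact Set.disjoint_left.2 fun x hx hx' => not_lt.2 hx'.1.1 hx.2
    _ ≤ _ := measureReal_mono hsub measure_Icc_diff_ne_top

/-- Above the gap of `[a, a + s]`, only products of points of the right third occur. -/
lemma defectAbove_right_le (hsp : Splits D a s) (hs : 0 < s) (ha : 0 ≤ a)
    (hq : (a + 2 * (s / 3)) ^ 2 - (s / 3) ^ 2 < q) :
    defectAbove D (a + 2 * (s / 3)) (s / 3) q ≤ defectAbove D a s q := by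
  have hgap : (a + s / 3) ^ 2 ≤ (a + 2 * (s / 3)) ^ 2 - (s / 3) ^ 2 := by nlinarith
  refine measureReal_mono ?_ measure_Icc_diff_ne_top
  rintro z ⟨⟨hz1, hz2⟩, hzP⟩
  refine ⟨⟨hz1, by rwa [show a + 2 * (s / 3) + s / 3 = a + s by ring] at hz2⟩, fun hz => ?_⟩
  rcases hsp.mem_products hs.le ha hz with hz | hz | hz
  · linarith [(products_subset_Icc ha hz).2]
  · linarith [hz.2]
  · exact hzP hz

/-- The defect of a triadic interval is at most the gap plus the defects of its two thirds, minus
the part missed by the left third that is filled by the products of the two thirds. -/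
lemma defect_le_sub (hD : IsCompact D) (hK : cantorSet ∩ Icc (2 / 3) 1 ⊆ D)
    (h : IsTriadic a s) :
    defect D a s ≤ s ^ 2 / 9 + defect D a (s / 3) + defect D (a + 2 * (s / 3)) (s / 3) -
      defectAbove D a (s / 3) ((a + s / 3) ^ 2 - (s / 3) ^ 2) := by
  have hs := h.pos
  have ha : 0 ≤ a := by linarith [h.le]
  have h1 : a ^ 2 ≤ (a + s / 3) ^ 2 - (s / 3) ^ 2 := by nlinarith
  have h2 : (a + s / 3) ^ 2 - (s / 3) ^ 2 ≤ (a + s) ^ 2 := by nlinarith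
  rw [defect_eq_add_defectAbove hD h1 h2,
    defect_eq_add_defectAbove (s := s / 3) hD h1 (by linarith [sq_nonneg (s / 3)])]
  have h3 := defectAbove_le hK h le_rfl
  have h4 : volume.real (Ico (a ^ 2) ((a + s / 3) ^ 2 - (s / 3) ^ 2) \ products D a s) ≤
      volume.real (Ico (a ^ 2) ((a + s / 3) ^ 2 - (s / 3) ^ 2) \ products D a (s / 3)) :=
    measureReal_mono (sdiff_subset_sdiff_right (products_mono le_rfl (by linarith)))
      measure_Ico_diff_ne_top
  linarith

lemma defect_le_add (hD : IsCompact D) (hK : cantorSet ∩ Icc (2 / 3) 1 ⊆ D)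
    (h : IsTriadic a s) :
    defect D a s ≤ s ^ 2 / 9 + defect D a (s / 3) + defect D (a + 2 * (s / 3)) (s / 3) := by
  linarith [defect_le_sub hD hK h,
    defectAbove_nonneg (D := D) (a := a) (s := s / 3) (q := (a + s / 3) ^ 2 - (s / 3) ^ 2)]

/-- The bound `defect_le_sub` is sharp when `D` avoids the middle third of `[a, a + s]`. -/
lemma le_defect (hD : IsCompact D) (hsp : Splits D a s) (hs : 0 < s) (ha : 0 ≤ a) :
    s ^ 2 / 9 + defect D a (s / 3) + defect D (a + 2 * (s / 3)) (s / 3) -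
      defectAbove D a (s / 3) ((a + s / 3) ^ 2 - (s / 3) ^ 2) ≤ defect D a s := by
  have h1 : a ^ 2 ≤ (a + s / 3) ^ 2 - (s / 3) ^ 2 := by nlinarith
  have h2 : (a + s / 3) ^ 2 - (s / 3) ^ 2 ≤ (a + s) ^ 2 := by nlinarith
  rw [defect_eq_add_defectAbove (s := s) hD h1 h2,
    defect_eq_add_defectAbove (s := s / 3) hD h1 (by linarith [sq_nonneg (s / 3)])]
  have h3 : s ^ 2 / 9 + defect D (a + 2 * (s / 3)) (s / 3) ≤
      defectAbove D a s ((a + s / 3) ^ 2 - (s / 3) ^ 2) :=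
    le_defectAbove hD hsp hs ha (by nlinarith)
  have h4 : volume.real (Ico (a ^ 2) ((a + s / 3) ^ 2 - (s / 3) ^ 2) \ products D a (s / 3)) ≤
      volume.real (Ico (a ^ 2) ((a + s / 3) ^ 2 - (s / 3) ^ 2) \ products D a s) := by
    refine measureReal_mono ?_ measure_Ico_diff_ne_top
    rintro z ⟨hz, hzP⟩
    refine ⟨hz, fun hz' => ?_⟩
    rcases hsp.mem_products hs.le ha hz' with hz' | hz' | hz'
    · exact hzP hz'
    · linarith [hz'.1, hz.2]
    · have := (products_subset_Icc (by positivity) hz').1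
      nlinarith [hz.2]
  linarith

lemma IsTriadic.le_third (h : IsTriadic a s) : s ≤ 1 / 3 := by linarith [h.le, h.add_le]

lemma IsTriadic.defect_le_two_mul (h : IsTriadic a s) : defect D a s ≤ 2 * s :=
  defect_le h.pos.le (by linarith [h.le]) h.add_le

/-- The gaps of all `2ᵏ` triadic subintervals of all levels `k` have total measure
`(s² / 9) ∑ (2 / 9)ᵏ = s² / 7`. -/
lemma defect_le_div_seven (hD : IsCompact D) (hK : cantorSet ∩ Icc (2 / 3) 1 ⊆ D)
    (h : IsTriadic a s) : defect D a s ≤ s ^ 2 / 7 := by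
  have key (n : ℕ) : ∀ {a s : ℝ}, IsTriadic a s →
      defect D a s ≤ s ^ 2 / 7 + 2 * s * (2 / 3) ^ n := by
    induction n with
    | zero =>
      intro a s h
      have := h.defect_le_two_mul (D := D)
      rw [pow_zero, mul_one]
      linarith [sq_nonneg s]
    | succ n ih =>
      intro a s h
      have h1 := ih h.left
      have h2 := ih h.right
      have h3 := defect_le_add hD hK h
      rw [pow_succ (2 / 3 : ℝ)]
      linarith
  have hlim : Filter.Tendsto (fun n : ℕ => s ^ 2 / 7 + 2 * s * (2 / 3 : ℝ) ^ n) Filter.atTop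
      (nhds (s ^ 2 / 7 + 2 * s * 0)) :=
    ((tendsto_pow_atTop_nhds_zero_of_lt_one (by norm_num) (by norm_num)).const_mul _).const_add _
  rw [mul_zero, add_zero] at hlim
  exact ge_of_tendsto' hlim fun n => key n h

/-- The loss term in `le_defect` is of fourth order: `[(a + s/3)² - (s/3)², (a + s/3)²]` consists of
squares of points of the triadic interval of length `(s/3)²` at the right end of the left third. -/
lemma defectAbove_left_le (hD : IsCompact D) (hK : cantorSet ∩ Icc (2 / 3) 1 ⊆ D)
    (h : IsTriadic a s) :
    defectAbove D a (s / 3) ((a + s / 3) ^ 2 - (s / 3) ^ 2) ≤ s ^ 4 / 567 := by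
  have hs := h.pos
  have hs3 := h.le_third
  have ha := h.le
  obtain ⟨m, hm⟩ := h.size
  have hu := h.left.spine_right (m + 1)
  have hsize : s / 3 / 3 ^ (m + 1) = (s / 3) ^ 2 := by
    rw [pow_succ, div_pow, sq s]
    nth_rw 3 [hm]
    field_simp
  rw [hsize] at hu
  have hpos : 0 ≤ 2 * (a + s / 3) - 1 - (s / 3) ^ 2 := by nlinarith
  calc _ ≤ defect D (a + s / 3 - (s / 3) ^ 2) ((s / 3) ^ 2) :=
        defectAbove_le_of_top_eq (by nlinarith [mul_nonneg (sq_nonneg (s / 3)) hpos])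
          (by nlinarith) (by ring)
    _ ≤ _ := defect_le_div_seven hD hK hu
    _ = _ := by ring

lemma le_defect_sub_pow (hD : IsCompact D) (hK : cantorSet ∩ Icc (2 / 3) 1 ⊆ D)
    (h : IsTriadic a s) (hsp : Splits D a s) :
    s ^ 2 / 9 + defect D a (s / 3) + defect D (a + 2 * (s / 3)) (s / 3) - s ^ 4 / 567 ≤
      defect D a s := by
  linarith [le_defect hD hsp h.pos (by linarith [h.le]), defectAbove_left_le hD hK h]

/-! ### Summation along a chain of nested triadic intervals -/

/-- Telescoping of an upper bound; the terms tend to `0`, so no remainder is left. -/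
lemma le_of_chain_le {F : ℕ → ℝ} {A B : ℝ}
    (hstep : ∀ j, F j ≤ A / 9 ^ j + F (j + 1)) (hF : ∀ j, F j ≤ B / 3 ^ j) :
    F 0 ≤ 9 / 8 * A := by
  have key (n : ℕ) : F 0 ≤ 9 / 8 * A * (1 - 1 / 9 ^ n) + F n := by
    induction n with
    | zero => simp
    | succ n ih =>
      have h1 := hstep n
      have h2 : 9 / 8 * A * (1 - 1 / 9 ^ (n + 1)) =
          9 / 8 * A * (1 - 1 / 9 ^ n) + A / 9 ^ n := by
        rw [pow_succ]; field_simp; ring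
      linarith
  have e9 : Filter.Tendsto (fun n : ℕ => (1 : ℝ) / 9 ^ n) Filter.atTop (nhds 0) := by
    simpa using tendsto_pow_atTop_nhds_zero_of_lt_one (r := (1 / 9 : ℝ)) (by norm_num)
      (by norm_num)
  have e3 : Filter.Tendsto (fun n : ℕ => (1 : ℝ) / 3 ^ n) Filter.atTop (nhds 0) := by
    simpa using tendsto_pow_atTop_nhds_zero_of_lt_one (r := (1 / 3 : ℝ)) (by norm_num)
      (by norm_num)
  have hlim := ((e9.const_sub 1).const_mul (9 / 8 * A)).add (e3.const_mul B)
  simp only [sub_zero, mul_one, mul_zero, add_zero] at hlim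
  refine ge_of_tendsto' hlim fun n => (key n).trans ?_
  have := hF n
  rw [mul_one_div]
  linarith

/-- Telescoping of a lower bound; the remainder is nonnegative and can be dropped. -/
lemma le_of_le_chain {F : ℕ → ℝ} {A B : ℝ}
    (hstep : ∀ j, A / 9 ^ j - B / 81 ^ j + F (j + 1) ≤ F j) (hF : ∀ j, 0 ≤ F j) :
    9 / 8 * A - 81 / 80 * B ≤ F 0 := by
  have key (n : ℕ) : 9 / 8 * A * (1 - 1 / 9 ^ n) - 81 / 80 * B * (1 - 1 / 81 ^ n) + F n ≤ F 0 := by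
    induction n with
    | zero => simp
    | succ n ih =>
      have h1 := hstep n
      have h2 : 9 / 8 * A * (1 - 1 / 9 ^ (n + 1)) =
          9 / 8 * A * (1 - 1 / 9 ^ n) + A / 9 ^ n := by
        rw [pow_succ]; field_simp; ring
      have h3 : 81 / 80 * B * (1 - 1 / 81 ^ (n + 1)) =
          81 / 80 * B * (1 - 1 / 81 ^ n) + B / 81 ^ n := by
        rw [pow_succ]; field_simp; ring
      linarith
  have e9 : Filter.Tendsto (fun n : ℕ => (1 : ℝ) / 9 ^ n) Filter.atTop (nhds 0) := by
    simpa using tendsto_pow_atTop_nhds_zero_of_lt_one (r := (1 / 9 : ℝ)) (by norm_num)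
      (by norm_num)
  have e81 : Filter.Tendsto (fun n : ℕ => (1 : ℝ) / 81 ^ n) Filter.atTop (nhds 0) := by
    simpa using tendsto_pow_atTop_nhds_zero_of_lt_one (r := (1 / 81 : ℝ)) (by norm_num)
      (by norm_num)
  have hlim := ((e9.const_sub 1).const_mul (9 / 8 * A)).sub
    ((e81.const_sub 1).const_mul (81 / 80 * B))
  simp only [sub_zero, mul_one] at hlim
  exact le_of_tendsto' hlim fun n => by linarith [key n, hF n]

/-! ### The defect at the nodes of the fast subdivision -/

lemma splits_left {b : ℕ} (hb : b < 3) {p : ℝ × ℝ} (hp : p ∈ leaves b) (k : ℕ) :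
    Splits (fastSubdivision 3) p.1 (p.2 / 3 ^ k) := by
  intro x hx _
  by_contra! hlt
  exact (fastSubdivision_antitone (Nat.succ_le_of_lt hb) hx).2
    ((isComponentSystem_fastSubdivision b).mem_removed_left hp k hlt.1 (by linarith [hlt.2]))

lemma splits_right {b : ℕ} (hb : b < 3) {p : ℝ × ℝ} (hp : p ∈ leaves b) (k : ℕ) :
    Splits (fastSubdivision 3) (p.1 + p.2 - p.2 / 3 ^ k) (p.2 / 3 ^ k) := by
  intro x hx _
  by_contra! hlt
  exact (fastSubdivision_antitone (Nat.succ_le_of_lt hb) hx).2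
    ((isComponentSystem_fastSubdivision b).mem_removed_right hp k (by linarith [hlt.1])
      (by linarith [hlt.2]))

/-- The defect of `[a, a + s]` is `κ s²` up to an error of fourth order in `s`. The constant `553`
is chosen such that the errors of the two thirds and the loss bounded in `defectAbove_left_le`
add up: `1 / 567 + 2 / (81 * 553) = 1 / 553`. -/
def DefectBounds (κ a s : ℝ) : Prop :=
  κ * s ^ 2 - s ^ 4 / 553 ≤ defect (fastSubdivision 3) a s ∧
    defect (fastSubdivision 3) a s ≤ κ * s ^ 2

/-- Two-sided bounds for a node both of whose thirds are under control. -/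
lemma DefectBounds.of_thirds {κ₁ κ₂ a s : ℝ} (h : IsTriadic a s)
    (hsp : Splits (fastSubdivision 3) a s) (h₁ : DefectBounds κ₁ a (s / 3))
    (h₂ : DefectBounds κ₂ (a + 2 * (s / 3)) (s / 3)) :
    DefectBounds ((1 + κ₁ + κ₂) / 9) a s := by
  have hD := isCompact_fastSubdivision 3
  have hK := cantorSet_inter_subset_fastSubdivision 3
  have hlo := le_defect_sub_pow hD hK h hsp
  have hhi := defect_le_add hD hK h
  exact ⟨by linarith [h₁.1, h₂.1], by linarith [h₁.2, h₂.2]⟩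

/-- A chain of nested nodes: of the two thirds of the `j`-th node, one is the next node, and the
other one has a defect controlled by `κ`. -/
lemma DefectBounds.of_chain {κ r : ℝ} {u : ℕ → ℝ} (h : ∀ j, IsTriadic (u j) (r / 3 ^ j))
    (hsp : ∀ j, Splits (fastSubdivision 3) (u j) (r / 3 ^ j))
    (hnext : ∀ j, (u (j + 1) = u j ∧
        DefectBounds κ (u j + 2 * (r / 3 ^ j / 3)) (r / 3 ^ j / 3)) ∨
      (u (j + 1) = u j + 2 * (r / 3 ^ j / 3) ∧ DefectBounds κ (u j) (r / 3 ^ j / 3))) :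
    DefectBounds ((1 + κ) / 8) (u 0) r := by
  have hD := isCompact_fastSubdivision 3
  have hK := cantorSet_inter_subset_fastSubdivision 3
  set F : ℕ → ℝ := fun j => defect (fastSubdivision 3) (u j) (r / 3 ^ j) with hF
  have hr (j : ℕ) : r / 3 ^ (j + 1) = r / 3 ^ j / 3 := by rw [pow_succ]; field_simp
  have e2 (j : ℕ) : (r / 3 ^ j) ^ 2 = r ^ 2 / 9 ^ j := by
    rw [div_pow, ← pow_mul, mul_comm j, pow_mul]; norm_num
  have e4 (j : ℕ) : (r / 3 ^ j) ^ 4 = r ^ 4 / 81 ^ j := by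
    rw [div_pow, ← pow_mul, mul_comm j, pow_mul]; norm_num
  have hsum (j : ℕ) : ∃ G, κ * (r / 3 ^ j / 3) ^ 2 - (r / 3 ^ j / 3) ^ 4 / 553 ≤ G ∧
      G ≤ κ * (r / 3 ^ j / 3) ^ 2 ∧
      defect (fastSubdivision 3) (u j) (r / 3 ^ j / 3) +
        defect (fastSubdivision 3) (u j + 2 * (r / 3 ^ j / 3)) (r / 3 ^ j / 3) = F (j + 1) + G := by
    rcases hnext j with ⟨hu, hb⟩ | ⟨hu, hb⟩
    · exact ⟨_, hb.1, hb.2, by simp only [hF, hu, hr]⟩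
    · exact ⟨_, hb.1, hb.2, by simp only [hF, hu, hr]; ring⟩
  have h0 : F 0 = defect (fastSubdivision 3) (u 0) r := by simp [hF]
  rw [DefectBounds, ← h0]
  constructor
  · have := le_of_le_chain (F := F) (A := (1 + κ) / 9 * r ^ 2)
      (B := (1 / 567 + 1 / (81 * 553)) * r ^ 4) (fun j => ?_) (fun j => defect_nonneg)
    · linarith
    · obtain ⟨G, hG1, -, hG⟩ := hsum j
      have h1 : _ ≤ F j := le_defect_sub_pow hD hK (h j) (hsp j)
      rw [mul_div_assoc, mul_div_assoc, ← e2, ← e4]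
      linarith
  · have := le_of_chain_le (F := F) (A := (1 + κ) / 9 * r ^ 2) (B := 2 * r)
      (fun j => ?_) (fun j => ?_)
    · linarith
    · obtain ⟨G, -, hG2, hG⟩ := hsum j
      have h1 : F j ≤ _ := defect_le_add hD hK (h j)
      rw [mul_div_assoc, ← e2]
      linarith
    · have : F j ≤ _ := (h j).defect_le_two_mul
      rwa [mul_div_assoc]

section Levels

variable {b : ℕ} {κ : ℝ} {p : ℝ × ℝ}

/-- Nodes at the left end of a component of level `b`, when the components of level `b + 1` are
under control. -/
lemma DefectBounds.spine_left (hb : b < 3) (hκ : ∀ q ∈ leaves (b + 1), DefectBounds κ q.1 q.2)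
    (hp : p ∈ leaves b) (k : ℕ) : DefectBounds ((1 + κ) / 8) p.1 (p.2 / 3 ^ (k + 1)) := by
  have e (j : ℕ) : p.2 / 3 ^ (k + 1) / 3 ^ j = p.2 / 3 ^ (k + j + 1) := by
    rw [div_div, ← pow_add]; congr 2; ring
  refine DefectBounds.of_chain (u := fun _ => p.1) (fun j => ?_) (fun j => ?_) (fun j => ?_)
  · rw [e]; exact (isTriadic_of_mem_leaves hp).spine_left _
  · rw [e]; exact splits_left hb hp _
  · rw [e]; exact Or.inl ⟨rfl, hκ _ ⟨p, hp, k + j, Or.inl rfl⟩⟩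

/-- Nodes at the right end of a component of level `b`, when the components of level `b + 1` are
under control. -/
lemma DefectBounds.spine_right (hb : b < 3) (hκ : ∀ q ∈ leaves (b + 1), DefectBounds κ q.1 q.2)
    (hp : p ∈ leaves b) (k : ℕ) :
    DefectBounds ((1 + κ) / 8) (p.1 + p.2 - p.2 / 3 ^ (k + 1)) (p.2 / 3 ^ (k + 1)) := by
  have e (j : ℕ) : p.2 / 3 ^ (k + 1) / 3 ^ j = p.2 / 3 ^ (k + j + 1) := by
    rw [div_div, ← pow_add]; congr 2; ring
  refine DefectBounds.of_chain (u := fun j => p.1 + p.2 - p.2 / 3 ^ (k + j + 1))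
    (fun j => ?_) (fun j => ?_) (fun j => ?_)
  · rw [e]; exact (isTriadic_of_mem_leaves hp).spine_right _
  · rw [e]; exact splits_right hb hp _
  · rw [e]
    refine Or.inr ⟨?_, hκ _ ⟨p, hp, k + j, Or.inr rfl⟩⟩
    rw [show k + (j + 1) + 1 = (k + j + 1) + 1 by ring, pow_succ _ (k + j + 1), ← div_div]
    ring

/-- The thirds of a component of level `b` are the first nodes of its two chains. -/
lemma DefectBounds.leaf (hb : b < 3) (hκ : ∀ q ∈ leaves (b + 1), DefectBounds κ q.1 q.2)
    (hp : p ∈ leaves b) : DefectBounds ((5 + κ) / 36) p.1 p.2 := by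
  have h1 := DefectBounds.spine_left hb hκ hp 0
  have h2 := DefectBounds.spine_right hb hκ hp 0
  have h3 := splits_left hb hp 0
  simp only [zero_add, pow_one, pow_zero, div_one] at h1 h2 h3
  rw [show p.1 + p.2 - p.2 / 3 = p.1 + 2 * (p.2 / 3) by ring] at h2
  convert DefectBounds.of_thirds (isTriadic_of_mem_leaves hp) h3 h1 h2 using 1
  ring

end Levels

lemma defectBounds_leaves_three : ∀ q ∈ leaves 3, DefectBounds 0 q.1 q.2 := by
  intro q hq
  have h := isTriadic_of_mem_leaves hq
  rw [DefectBounds, defect_eq_zero h.pos.le (by linarith [h.le])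
    ((isComponentSystem_fastSubdivision 3).subset q hq)]
  constructor
  · have := h.pos
    have : 0 ≤ q.2 ^ 4 := by positivity
    linarith
  · simp

lemma defectBounds_leaves_two : ∀ q ∈ leaves 2, DefectBounds (5 / 36) q.1 q.2 := by
  intro q hq
  convert DefectBounds.leaf (by norm_num) defectBounds_leaves_three hq using 1
  norm_num

lemma defectBounds_leaves_one : ∀ q ∈ leaves 1, DefectBounds (185 / 1296) q.1 q.2 := by
  intro q hq
  convert DefectBounds.leaf (by norm_num) defectBounds_leaves_two hq using 1
  norm_num

/-! ### The defect of `[2/3, 1]` -/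

lemma mem_leaves_zero : ((2 / 3, 1 / 3) : ℝ × ℝ) ∈ leaves 0 := rfl

lemma mem_leaves_one_left : ((20 / 27, 1 / 27) : ℝ × ℝ) ∈ leaves 1 :=
  ⟨_, mem_leaves_zero, 0, Or.inl (by norm_num)⟩

lemma mem_leaves_one_left' : ((56 / 81, 1 / 81) : ℝ × ℝ) ∈ leaves 1 :=
  ⟨_, mem_leaves_zero, 1, Or.inl (by norm_num)⟩

lemma mem_leaves_one_right : ((8 / 9, 1 / 27) : ℝ × ℝ) ∈ leaves 1 :=
  ⟨_, mem_leaves_zero, 0, Or.inr (by norm_num)⟩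

/-- The loss term of `[2/3, 1]`, as an equality. The threshold is `48/81 = (7/9)² - (1/9)²`. Of the
points above it missed by the products of `D ∩ [2/3, 7/9]`, some lie in the gap of `[62/81, 63/81]`,
which lies entirely above the threshold, and the others are missed by the right third
`[188/243, 7/9]` of that interval. -/
lemma defectAbove_left_third_bounds :
    1 / 9 ^ 5 + defect (fastSubdivision 3) (188 / 243) (1 / 243) ≤
      defectAbove (fastSubdivision 3) (2 / 3) (1 / 9) (48 / 81) ∧
    defectAbove (fastSubdivision 3) (2 / 3) (1 / 9) (48 / 81) ≤
      1 / 9 ^ 5 + defect (fastSubdivision 3) (188 / 243) (1 / 243) := by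
  have hD := isCompact_fastSubdivision 3
  have hK := cantorSet_inter_subset_fastSubdivision 3
  have s0 := splits_left (by norm_num) mem_leaves_zero 1
  have s1 := splits_left (by norm_num) mem_leaves_one_left 0
  have s2 := splits_right (by norm_num) mem_leaves_one_left 1
  have t2 := (isTriadic_of_mem_leaves mem_leaves_one_left).spine_right 1
  norm_num at s0 s1 s2 t2
  constructor
  · have h3 := le_defectAbove (q := (188 / 243) ^ 2 - (1 / 243) ^ 2) hD s2 (by norm_num)
      (by norm_num) (by norm_num)
    have h2 := defectAbove_right_le (q := (188 / 243) ^ 2 - (1 / 243) ^ 2) s1 (by norm_num)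
      (by norm_num) (by norm_num)
    have h1 := defectAbove_right_le (q := (188 / 243) ^ 2 - (1 / 243) ^ 2) s0 (by norm_num)
      (by norm_num) (by norm_num)
    have h0 := defectAbove_le_of_top_eq (D := fastSubdivision 3) (a := 2 / 3) (s := 1 / 9)
      (q' := 48 / 81) (q := (188 / 243) ^ 2 - (1 / 243) ^ 2) (by norm_num) le_rfl rfl
    norm_num at h0 h1 h2 h3 ⊢
    linarith
  · -- The threshold lies inside the interval `Q` of the outer thirds of `[62/81, 63/81]`.
    have h1 := defectAbove_le (q := 48 / 81) hK t2 (by norm_num)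
    have h0 := defectAbove_le_of_top_eq (D := fastSubdivision 3) (a := 2 / 3) (s := 1 / 9)
      (a' := 62 / 81) (s' := 1 / 81)
      (q' := 48 / 81) (q := 48 / 81) (by norm_num) (by norm_num) (by norm_num)
    norm_num at h0 h1 ⊢
    linarith

/-- A lower bound for the loss term of `[2/3, 7/9]`, whose threshold is
`360/729 = (19/27)² - (1/27)²`: the gap of `[512/729, 19/27]` lies above it. -/
lemma le_defectAbove_left_ninth :
    1 / 9 ^ 7 + defect (fastSubdivision 3) (1538 / 2187) (1 / 2187) ≤
      defectAbove (fastSubdivision 3) (2 / 3) (1 / 27) (360 / 729) := by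
  have hD := isCompact_fastSubdivision 3
  have s0 := splits_left (by norm_num) mem_leaves_zero 2
  have s1 := splits_left (by norm_num) mem_leaves_one_left' 0
  have s2 := splits_right (by norm_num) mem_leaves_one_left' 1
  have s3 := splits_right (by norm_num) mem_leaves_one_left' 2
  norm_num at s0 s1 s2 s3
  have h4 := le_defectAbove (q := (1538 / 2187) ^ 2 - (1 / 2187) ^ 2) hD s3 (by norm_num)
    (by norm_num) (by norm_num)
  have h3 := defectAbove_right_le (q := (1538 / 2187) ^ 2 - (1 / 2187) ^ 2) s2 (by norm_num)
    (by norm_num) (by norm_num)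
  have h2 := defectAbove_right_le (q := (1538 / 2187) ^ 2 - (1 / 2187) ^ 2) s1 (by norm_num)
    (by norm_num) (by norm_num)
  have h1 := defectAbove_right_le (q := (1538 / 2187) ^ 2 - (1 / 2187) ^ 2) s0 (by norm_num)
    (by norm_num) (by norm_num)
  have h0 := defectAbove_le_of_top_eq (D := fastSubdivision 3) (a := 2 / 3) (s := 1 / 27)
    (q' := 360 / 729) (q := (1538 / 2187) ^ 2 - (1 / 2187) ^ 2) (by norm_num) le_rfl rfl
  norm_num at h0 h1 h2 h3 h4 ⊢
  linarith

/-- The loss term of `[8/9, 1]`, as an equality. The threshold is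
`624/729 = (25/27)² - (1/27)²`, and the gap of `[674/729, 25/27]` lies above it. -/
lemma defectAbove_right_ninth_bounds :
    1 / 9 ^ 7 + defect (fastSubdivision 3) (2024 / 2187) (1 / 2187) ≤
      defectAbove (fastSubdivision 3) (8 / 9) (1 / 27) (624 / 729) ∧
    defectAbove (fastSubdivision 3) (8 / 9) (1 / 27) (624 / 729) ≤
      1 / 9 ^ 7 + defect (fastSubdivision 3) (2024 / 2187) (1 / 2187) := by
  have hD := isCompact_fastSubdivision 3
  have hK := cantorSet_inter_subset_fastSubdivision 3
  have s0 := splits_left (by norm_num) mem_leaves_one_right 0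
  have s1 := splits_right (by norm_num) mem_leaves_one_right 1
  have s2 := splits_right (by norm_num) mem_leaves_one_right 2
  have s3 := splits_right (by norm_num) mem_leaves_one_right 3
  have t3 := (isTriadic_of_mem_leaves mem_leaves_one_right).spine_right 3
  norm_num at s0 s1 s2 s3 t3
  constructor
  · have h4 := le_defectAbove (q := (2024 / 2187) ^ 2 - (1 / 2187) ^ 2) hD s3 (by norm_num)
      (by norm_num) (by norm_num)
    have h3 := defectAbove_right_le (q := (2024 / 2187) ^ 2 - (1 / 2187) ^ 2) s2 (by norm_num)
      (by norm_num) (by norm_num)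
    have h2 := defectAbove_right_le (q := (2024 / 2187) ^ 2 - (1 / 2187) ^ 2) s1 (by norm_num)
      (by norm_num) (by norm_num)
    have h1 := defectAbove_right_le (q := (2024 / 2187) ^ 2 - (1 / 2187) ^ 2) s0 (by norm_num)
      (by norm_num) (by norm_num)
    have h0 := defectAbove_le_of_top_eq (D := fastSubdivision 3) (a := 8 / 9) (s := 1 / 27)
      (q' := 624 / 729) (q := (2024 / 2187) ^ 2 - (1 / 2187) ^ 2) (by norm_num) le_rfl rfl
    norm_num at h0 h1 h2 h3 h4 ⊢
    linarith
  · -- The threshold lies inside the interval `Q` of the outer thirds of `[674/729, 25/27]`.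
    have h1 := defectAbove_le (q := 624 / 729) hK t3 (by norm_num)
    have h0 := defectAbove_le_of_top_eq (D := fastSubdivision 3) (a := 8 / 9) (s := 1 / 27)
      (a' := 674 / 729) (s' := 1 / 729)
      (q' := 624 / 729) (q := 624 / 729) (by norm_num) (by norm_num) (by norm_num)
    norm_num at h0 h1 ⊢
    linarith

/-- The products of points of `[2/3, 1]` lie in `[4/9, 1]`, which has measure `5/9`. -/
lemma volume_prodMap_image :
    (volume (prodMap '' (fastSubdivision 3 ×ˢ fastSubdivision 3))).toReal =
      5 / 9 - defect (fastSubdivision 3) (2 / 3) (1 / 3) := by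
  have hD := isCompact_fastSubdivision 3
  have hsub : fastSubdivision 3 ⊆ Icc (2 / 3) (2 / 3 + 1 / 3) := by
    have : fastSubdivision 3 ⊆ fastSubdivision 0 := fastSubdivision_antitone (Nat.zero_le 3)
    rwa [show (2 : ℝ) / 3 + 1 / 3 = 1 by norm_num]
  have hP : prodMap '' (fastSubdivision 3 ×ˢ fastSubdivision 3) =
      products (fastSubdivision 3) (2 / 3) (1 / 3) := by
    rw [products, inter_eq_left.2 hsub]
  have h := measureReal_sdiff_add_inter (μ := volume)
    (s := Icc ((2 / 3 : ℝ) ^ 2) ((2 / 3 + 1 / 3) ^ 2))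
    (measurableSet_products (a := 2 / 3) (s := 1 / 3) hD) measure_Icc_lt_top.ne
  rw [inter_eq_right.2 (products_subset_Icc (by norm_num)),
    Real.volume_real_Icc_of_le (by norm_num)] at h
  rw [hP, defect, defectAbove]
  change volume.real _ = _
  rw [eq_sub_iff_add_eq, add_comm, h]
  norm_num

end CantorProduct

open CantorProduct in
theorem proposition3 :
    |(MeasureTheory.volume
        (CantorProduct.prodMap ''
          (CantorProduct.fastSubdivision 3 ×ˢ CantorProduct.fastSubdivision 3))).toReal
        - (91782451 : ℝ) / 170061120| ≤ (1 : ℝ) / (64 * 9 ^ 6) := by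
  have hD := isCompact_fastSubdivision 3
  have hK := cantorSet_inter_subset_fastSubdivision 3
  have hroot := mem_leaves_zero
  have hone := defectBounds_leaves_one
  have htwo := defectBounds_leaves_two
  have t2 := isTriadic_of_mem_leaves hroot
  have t20 := t2.spine_left 1
  have t22 := t2.spine_right 1
  have s2 := splits_left (by norm_num) hroot 0
  have s20 := splits_left (by norm_num) hroot 1
  have s22 := splits_right (by norm_num) hroot 1
  -- Defects of the ninths of `[2/3, 7/9]` and `[8/9, 1]`.
  have b200 := DefectBounds.spine_left (by norm_num) hone hroot 1
  have b202 := hone _ mem_leaves_one_left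
  have b220 := hone _ mem_leaves_one_right
  have b222 := DefectBounds.spine_right (by norm_num) hone hroot 1
  -- Defects entering the loss terms of `[2/3, 1]`, `[2/3, 7/9]` and `[8/9, 1]`.
  have c2 := DefectBounds.spine_right (by norm_num) htwo mem_leaves_one_left 1
  have c20 := DefectBounds.spine_right (by norm_num) htwo mem_leaves_one_left' 2
  have c22 := DefectBounds.spine_right (by norm_num) htwo mem_leaves_one_right 3
  obtain ⟨l2, l2'⟩ := defectAbove_left_third_bounds
  have l20 := le_defectAbove_left_ninth
  obtain ⟨l22, l22'⟩ := defectAbove_right_ninth_bounds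
  norm_num [DefectBounds] at t20 t22 s2 s20 s22 b200 b202 b220 b222 c2 c20 c22 l2 l2' l20 l22 l22'
  -- The recursion in both directions. For the lower bound at `[2/3, 7/9]` the general estimate of
  -- the loss term is precise enough.
  have u2 := defect_le_sub hD hK t2
  have u20 := defect_le_sub hD hK t20
  have u22 := defect_le_sub hD hK t22
  have v2 := le_defect hD s2 (by norm_num) (by norm_num)
  have v20 := le_defect_sub_pow hD hK t20 s20
  have v22 := le_defect hD s22 (by norm_num) (by norm_num)
  norm_num at u2 u20 u22 v2 v20 v22
  rw [volume_prodMap_image, abs_le]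
  norm_num
  constructor
  · linarith
  · linarith
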